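/- Let $k\ge 2$ and $n,d\ge 1$. Let $\mu^\natural_1,\dots,\mu^\natural_k\in\mathbb{R}^d$ be ball centers, put $\Delta:=\min_{a\ne b}\|\mu^\natural_a-\mu^\natural_b\|$, and let $\sigma:[n]\to[k]$ be a planted cluster assignment that is balanced, i.e. all of whose fibers have the same size. Fix an initialization $\mu^0=(\mu^0_1,\dots,\mu^0_k)\in(\mathbb{R}^d)^k$ and let $$\delta:=\min_{\pi\in S_k}\max_{j\in[k]}\|\mu^0_{\pi(j)}-\mu^\natural_j\|$$ denote its distance from the planted means. Draw data from the stochastic ball model: $x_i=\mu^\natural_{\sigma(i)}+g_i$, where $g_1,\dots,g_n$ are independent copies of a random vector whose distribution is rotationally invariant and supported on the closed unit ball of $\mathbb{R}^d$. The first BalLOT update $F^1$ is a minimizer of $\sum_{i,j}F_{ij}\|x_i-\mu^0_j\|^2$ over all nonnegative $F\in\mathbb{R}^{n\times k}$ whose columns each sum to $1/k$ and whose rows each sum to $1/n$. The misclustering ratio of $F$ is $\min_{\pi\in S_k}\sum_{i}\sum_{j\ne\pi(\sigma(i))}F_{ij}$; if $F_{ij}=\frac1n\mathbf 1_{\{\sigma^1(i)=j\}}$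 for an assignment $\sigma^1$, then this equals $\min_{\pi\in S_k}|\{i:\sigma^1(i)\ne\pi(\sigma(i))\}|/n$. For $\varepsilon\in(0,1)$ put $$B(k,n,d,\Delta,\delta,\varepsilon):=k(k-1)\left[\exp\!\Big(-\frac d2\,\max\Big\{\frac\Delta2-\delta,\,0\Big\}^2\Big)+\sqrt{\frac{k}{2n}\log\frac{k(k-1)}{\varepsilon}}\,\right].$$ Then for every $\varepsilon\in(0,1)$, with probability at least $1-\varepsilon$, every first BalLOT update $F^1$ has misclustering ratio at most $B(k,n,d,\Delta,\delta,\varepsilon)$. Moreover, $B$ is strictly decreasing in $n\ge1$, nonincreasing in $d$ and in $\Delta$, and nondecreasing in $\delta$; in the regime $\delta<\Delta/2$ it is strictly decreasing in $d$ and, for $d\ge1$, strictly decreasing in $\Delta$ and strictly increasing in $\delta$. -/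

import Mathlib

open MeasureTheory ProbabilityTheory

noncomputable section

namespace BalLOT

/-- Euclidean space `ℝᵈ`. -/
abbrev E (d : ℕ) : Type := EuclideanSpace ℝ (Fin d)

/-- The cluster assignment `σ : [n] → [k]` is balanced: all its fibers have the same size. -/
def IsBalanced {n k : ℕ} (σ : Fin n → Fin k) : Prop :=
  ∀ a b : Fin k,
    (Finset.univ.filter fun i => σ i = a).card = (Finset.univ.filter fun i => σ i = b).card

/-- `ν` is a rotationally invariant probability distribution on the closed unit ball of `ℝᵈ`. -/
structure IsRotInvariantOnUnitBall {d : ℕ} (ν : Measure (E d)) : Prop where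
  isProbabilityMeasure : IsProbabilityMeasure ν
  map_eq : ∀ U : E d ≃ₗᵢ[ℝ] E d, ν.map U = ν
  ae_mem_ball : ∀ᵐ y ∂ν, y ∈ Metric.closedBall (0 : E d) 1

/-- The random points `x₁, …, xₙ` follow the stochastic ball model with ball centers `c` and
ground truth assignment `σ`: `xᵢ = c_{σ(i)} + gᵢ`, with `g₁, …, gₙ` independent copies of a random
vector with rotationally invariant distribution over the unit ball. -/
def IsStochasticBallModel {Ω : Type*} [MeasurableSpace Ω] (P : Measure Ω) {n k d : ℕ}
    (c : Fin k → E d) (σ : Fin n → Fin k) (x : Fin n → Ω → E d) : Prop :=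
  ∃ (ν : Measure (E d)) (g : Fin n → Ω → E d),
    IsRotInvariantOnUnitBall ν ∧
    (∀ i, Measurable (g i)) ∧
    (∀ i, P.map (g i) = ν) ∧
    iIndepFun g P ∧
    ∀ i ω, x i ω = c (σ i) + g i ω

/-- The objective `f(F, μ) = ∑ᵢ ∑ⱼ Fᵢⱼ ‖xᵢ - μⱼ‖²`. -/
def objective {n k d : ℕ} (x : Fin n → E d) (F : Matrix (Fin n) (Fin k) ℝ)
    (μ : Fin k → E d) : ℝ :=
  ∑ i, ∑ j, F i j * ‖x i - μ j‖ ^ 2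

/-- The transport polytope `𝒰ₙₖ`. -/
def couplings (n k : ℕ) : Set (Matrix (Fin n) (Fin k) ℝ) :=
  {F | (∀ i j, 0 ≤ F i j) ∧ (∀ j, ∑ i, F i j = 1 / (k : ℝ)) ∧ ∀ i, ∑ j, F i j = 1 / (n : ℝ)}

/-- `F` is a first BalLOT update `F¹` for the data `x` and the initialization `μ₀`: it minimizes
`f(·, μ₀)` over the transport polytope. -/
def IsFirstUpdate {n k d : ℕ} (x : Fin n → E d) (μ₀ : Fin k → E d)
    (F : Matrix (Fin n) (Fin k) ℝ) : Prop :=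
  F ∈ couplings n k ∧ IsMinOn (fun G => objective x G μ₀) (couplings n k) F

/-- The misclustering ratio of `F` relative to the planted assignment `σ`: the total mass that `F`
puts on wrong pairs, minimized over all relabelings of the clusters. -/
def misclusteringRatio {n k : ℕ} (σ : Fin n → Fin k) (F : Matrix (Fin n) (Fin k) ℝ) : ℝ :=
  ⨅ π : Equiv.Perm (Fin k), ∑ i, ∑ j, if j = π (σ i) then 0 else F i j

/-- The integral coupling `Fᵢⱼ = (1/n) 1{τ(i) = j}` of a cluster assignment `τ`. -/
def assignmentCoupling {n k : ℕ} (τ : Fin n → Fin k) : Matrix (Fin n) (Fin k) ℝ :=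
  fun i j => if τ i = j then 1 / (n : ℝ) else 0

/-- For an integral coupling, the misclustering ratio is the proportion of misclustered indices,
minimized over all relabelings of the clusters. -/
theorem misclusteringRatio_assignmentCoupling {n k : ℕ} (σ τ : Fin n → Fin k) :
    misclusteringRatio σ (assignmentCoupling τ) =
      ⨅ π : Equiv.Perm (Fin k),
        ((Finset.univ.filter fun i => τ i ≠ π (σ i)).card : ℝ) / (n : ℝ) := by
  unfold misclusteringRatio assignmentCoupling
  congr 1
  funext π
  have h : ∀ i : Fin n,
      (∑ j, if j = π (σ i) then (0 : ℝ) else if τ i = j then 1 / (n : ℝ) else 0) =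
        if τ i ≠ π (σ i) then 1 / (n : ℝ) else 0 := by
    intro i
    rw [Finset.sum_eq_single (τ i)]
    · by_cases hi : τ i = π (σ i) <;> simp [hi]
    · intro j _ hj
      simp [Ne.symm hj]
    · simp
  rw [Finset.sum_congr rfl fun i _ => h i, ← Finset.sum_filter, Finset.sum_const, nsmul_eq_mul]
  ring

/-- The separation `Δ = min_{a ≠ b} ‖c_a - c_b‖` of the ball centers. -/
def separation {k d : ℕ} (c : Fin k → E d) : ℝ :=
  ⨅ p : {p : Fin k × Fin k // p.1 ≠ p.2}, ‖c p.1.1 - c p.1.2‖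

/-- The distance between the initialization and the planted means:
the maximum over `j` of `‖μ₀_{π(j)} - c_j‖`, for the best indexing `π` of the initialization. -/
def initDist {k d : ℕ} (μ₀ c : Fin k → E d) : ℝ :=
  ⨅ π : Equiv.Perm (Fin k), ⨆ j, ‖μ₀ (π j) - c j‖

/-- The explicit upper bound on the misclustering ratio
`k (k-1) (exp(-(d/2) max(Δ/2 - δ, 0)²) + √((k/(2n)) log(k(k-1)/ε)))`. -/
def ratioBound (k n d : ℕ) (Δ δ ε : ℝ) : ℝ :=
  (k : ℝ) * ((k : ℝ) - 1) *
    (Real.exp (-((d : ℝ) / 2) * (max (Δ / 2 - δ) 0) ^ 2) +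
      Real.sqrt ((k : ℝ) / (2 * (n : ℝ)) * Real.log ((k : ℝ) * ((k : ℝ) - 1) / ε)))

end BalLOT

end

/-!
The argument has a deterministic and a probabilistic half.

*Optimality.* Reindex the initial centers so that each is within `δ` of its planted mean, and regard
the couplings as transport plans for a cost `C i j = ‖xᵢ - μⱼ‖²`. A pair `(i, j)` with `j` not the
label of `i` is *bad* if `j` is at least as cheap for `i` as its own label. Consider the digraph on
labels with an edge `a → j` whenever an optimal plan sends mass to `j` from a point of label `a` for
which `j` is strictly more expensive. A cycle in it could be cancelled with a gain
(`exists_improving_direction`), so the digraph is acyclic and has a ranking `r : [k] → {0, …, k-1}`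
which increases along edges. Since the plan and the planted assignment have the same column sums,
the total increase of `r` weighted by the plan is zero. Good pairs increase `r` by at least one,
bad pairs decrease it by at most `k - 1`, so that the misplaced mass is at most `k` times the mass
on bad pairs (`sum_offLabel_le`).

*Concentration.* If `(i, b)` is bad for a point of label `a`, then the noise satisfies
`⟪gᵢ, v⟫ ≥ (Δ/2 - δ) ‖v‖` with `v = μ_b - μ_a` (`inner_ge_of_dist_le`). By rotation invariance the
moment generating function of `⟪g, w⟫` depends only on `‖w‖`, hence equals its average over the
vectors `s (±1, …, ±1)` of the same norm. That average is `∏ cosh (s gᵢ) ≤ exp (s² / 2)`, so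
`⟪g, u⟫` is subgaussian with variance proxy `1/d` for unit `u` (`hasSubgaussianMGF_inner`). This
bounds the probability of a bad pair by the exponential term of the bound. Hoeffding's inequality
on each of the `k` fibers, each of size `n/k`, and a union bound over the `k (k - 1)` pairs of
labels give the square root term.
-/

namespace BalLOT

/-! ### Optimal couplings -/

section Optimality

variable {n k : ℕ} {C F : Matrix (Fin n) (Fin k) ℝ} {τ : Fin n → Fin k}

/-- The relation on labels given by the strictly unfavorable moves of the coupling `F`: there is
mass going to `j` from a point of label `a` that would be strictly cheaper to send to `a`. -/
def CostlyMove (C F : Matrix (Fin n) (Fin k) ℝ) (τ : Fin n → Fin k) (a j : Fin k) : Prop :=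
  ∃ i, τ i = a ∧ 0 < F i j ∧ C i a < C i j

/-- A path of costly moves from `a` to `b` can be undone at a gain: the change of coupling which
returns mass along the path preserves row sums, and column sums except at the endpoints. -/
theorem exists_improving_direction {a b : Fin k}
    (h : Relation.TransGen (CostlyMove C F τ) a b) :
    ∃ D : Matrix (Fin n) (Fin k) ℝ, (∀ i, ∑ j, D i j = 0) ∧
      (∀ j, ∑ i, D i j = (if j = a then 1 else 0) - (if j = b then 1 else 0)) ∧
      (∀ i j, D i j < 0 → 0 < F i j) ∧ ∑ i, ∑ j, D i j * C i j < 0 := by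
  have step : ∀ a j : Fin k, CostlyMove C F τ a j →
      ∃ D : Matrix (Fin n) (Fin k) ℝ, (∀ i, ∑ j, D i j = 0) ∧
      (∀ l, ∑ i, D i l = (if l = a then 1 else 0) - (if l = j then 1 else 0)) ∧
      (∀ i j, D i j < 0 → 0 < F i j) ∧ ∑ i, ∑ j, D i j * C i j < 0 := by
    rintro a j ⟨i₀, -, hF, hC⟩
    refine ⟨fun i l => if i = i₀ then (if l = a then 1 else 0) - (if l = j then 1 else 0) else 0,
      ?_, ?_, ?_, ?_⟩
    · intro i
      by_cases hi : i = i₀ <;> simp [hi]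
    · intro l
      simp
    · intro i l hil
      beta_reduce at hil
      by_cases hi : i = i₀
      · by_cases hl : l = j
        · rw [hi, hl]; exact hF
        · rw [if_pos hi, if_neg hl] at hil
          split_ifs at hil <;> norm_num at hil
      · simp [hi] at hil
    · rw [Finset.sum_eq_single i₀ (fun i _ hi => by simp [hi]) (by simp)]
      simp only [if_true, sub_mul, ite_mul, one_mul, zero_mul, Finset.sum_sub_distrib,
        Finset.sum_ite_eq', Finset.mem_univ]
      linarith
  induction h with
  | single h => exact step _ _ h
  | tail _ h ih =>
    obtain ⟨D, hr, hc, hp, hn⟩ := ih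
    obtain ⟨D', hr', hc', hp', hn'⟩ := step _ _ h
    refine ⟨D + D', fun i => ?_, fun j => ?_, fun i j hij => ?_, ?_⟩
    · simp [Finset.sum_add_distrib, hr, hr']
    · simp [Finset.sum_add_distrib, hc, hc']
    · by_cases h0 : D i j < 0
      · exact hp i j h0
      · refine hp' i j ?_
        simp only [Matrix.add_apply] at hij
        linarith
    · simp only [Matrix.add_apply, add_mul, Finset.sum_add_distrib]
      linarith

/-- A small multiple of a matrix whose negative entries lie in the support of `F` can be added
to `F` without leaving the nonnegative orthant. -/
theorem exists_pos_forall_nonneg_add_mul (hF : ∀ i j, 0 ≤ F i j) {D : Matrix (Fin n) (Fin k) ℝ}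
    (hD : ∀ i j, D i j < 0 → 0 < F i j) :
    ∃ s : ℝ, 0 < s ∧ ∀ i j, 0 ≤ F i j + s * D i j := by
  have key : ∀ p : Fin n × Fin k, ∀ᶠ s in nhdsWithin (0 : ℝ) (Set.Ioi 0),
      0 ≤ F p.1 p.2 + s * D p.1 p.2 := by
    intro p
    by_cases h : D p.1 p.2 < 0
    · have hc : Filter.Tendsto (fun s : ℝ => F p.1 p.2 + s * D p.1 p.2)
          (nhdsWithin 0 (Set.Ioi 0)) (nhds (F p.1 p.2 + 0 * D p.1 p.2)) :=
        (Continuous.tendsto (by fun_prop) 0).mono_left nhdsWithin_le_nhds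
      rw [zero_mul, add_zero] at hc
      exact (hc.eventually (lt_mem_nhds (hD _ _ h))).mono fun s hs => hs.le
    · filter_upwards [self_mem_nhdsWithin] with s hs
      exact add_nonneg (hF _ _) (mul_nonneg (le_of_lt hs) (not_lt.1 h))
  obtain ⟨s, hs, hs'⟩ := ((Filter.eventually_all.2 key).and self_mem_nhdsWithin).exists
  exact ⟨s, hs', fun i j => hs (i, j)⟩

/-- The costly moves of an optimal coupling do not form a cycle. -/
theorem not_transGen_costlyMove (hF : F ∈ couplings n k)
    (hmin : ∀ G ∈ couplings n k, ∑ i, ∑ j, F i j * C i j ≤ ∑ i, ∑ j, G i j * C i j) (a : Fin k) :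
    ¬ Relation.TransGen (CostlyMove C F τ) a a := by
  intro h
  obtain ⟨D, hr, hc, hp, hn⟩ := exists_improving_direction h
  obtain ⟨s, hs, hs'⟩ := exists_pos_forall_nonneg_add_mul hF.1 hp
  have hG := hmin (fun i j => F i j + s * D i j) ⟨hs', fun j => ?_, fun i => ?_⟩
  · simp only [add_mul, Finset.sum_add_distrib, mul_assoc, ← Finset.mul_sum] at hG
    nlinarith
  · simp [Finset.sum_add_distrib, ← Finset.mul_sum, hc, hF.2.1 j]
  · simp [Finset.sum_add_distrib, ← Finset.mul_sum, hr, hF.2.2 i]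

/-- An irreflexive transitive closure on `k` labels admits a ranking with values below `k`:
the number of ancestors. -/
theorem exists_rank_of_acyclic {R : Fin k → Fin k → Prop}
    (hR : ∀ a, ¬ Relation.TransGen R a a) :
    ∃ r : Fin k → ℕ, (∀ a, r a < k) ∧ ∀ a b, R a b → r a < r b := by
  classical
  refine ⟨fun a => (Finset.univ.filter fun b => Relation.TransGen R b a).card, fun a => ?_,
    fun a b hab => ?_⟩
  · have : (Finset.univ.filter fun b => Relation.TransGen R b a).card < Finset.univ.card :=
      Finset.card_lt_card <| Finset.filter_ssubset.2 ⟨a, Finset.mem_univ a, hR a⟩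
    simpa using this
  · refine Finset.card_lt_card (Finset.ssubset_iff_of_subset ?_ |>.2 ⟨a, ?_, ?_⟩)
    · intro c hc
      simp only [Finset.mem_filter, Finset.mem_univ, true_and] at hc ⊢
      exact hc.tail hab
    · simpa using Relation.TransGen.single hab
    · simpa using hR a

/-- For an optimal coupling, the mass on pairs `(i, j)` with `j ≠ τ i` is at most `k` times the
mass on those among them for which `j` is at least as cheap for `i` as `τ i`. -/
theorem sum_offLabel_le (hF : F ∈ couplings n k)
    (hmin : ∀ G ∈ couplings n k, ∑ i, ∑ j, F i j * C i j ≤ ∑ i, ∑ j, G i j * C i j)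
    (hτ : ∀ a, ((Finset.univ.filter fun i => τ i = a).card : ℝ) * (1 / n) = 1 / k) :
    ∑ i, ∑ j, (if j = τ i then 0 else F i j) ≤
      k * ∑ i, ∑ j, (if j ≠ τ i ∧ C i j ≤ C i (τ i) then F i j else 0) := by
  obtain ⟨r, hrk, hr⟩ := exists_rank_of_acyclic (not_transGen_costlyMove (τ := τ) hF hmin)
  -- Both `F` and the planted assignment give mass `1/k` to every label.
  have hbal : ∑ i, ∑ j, F i j * ((r j : ℝ) - r (τ i)) = 0 := by
    have h1 : ∑ i, ∑ j, F i j * (r j : ℝ) = ∑ j, 1 / (k : ℝ) * r j := by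
      rw [Finset.sum_comm]
      exact Finset.sum_congr rfl fun j _ => by rw [← Finset.sum_mul, hF.2.1 j]
    have h2 : ∑ i, ∑ j, F i j * (r (τ i) : ℝ) = ∑ j, 1 / (k : ℝ) * r j := by
      simp_rw [← Finset.sum_mul, hF.2.2]
      rw [← Finset.sum_fiberwise _ τ]
      refine Finset.sum_congr rfl fun a _ => ?_
      rw [← hτ a, Finset.sum_congr rfl fun i hi => by rw [(Finset.mem_filter.1 hi).2],
        Finset.sum_const, nsmul_eq_mul, mul_assoc]
    simp only [mul_sub, Finset.sum_sub_distrib, h1, h2, sub_self]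
  -- Costly pairs raise the rank by at least `1`, the others lower it by at most `k - 1`.
  have hpt : ∀ i j, (if j = τ i then 0 else F i j) ≤
      k * (if j ≠ τ i ∧ C i j ≤ C i (τ i) then F i j else 0) +
        F i j * ((r j : ℝ) - r (τ i)) := by
    intro i j
    have hFij := hF.1 i j
    by_cases hj : j = τ i
    · simp [hj]
    by_cases hC : C i j ≤ C i (τ i)
    · have h1 : (r (τ i) : ℝ) + 1 ≤ k := by exact_mod_cast hrk (τ i)
      have h2 : (0 : ℝ) ≤ r j := Nat.cast_nonneg _
      rw [if_neg hj, if_pos ⟨hj, hC⟩]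
      nlinarith
    · rw [if_neg hj, if_neg (fun h => hC h.2), mul_zero, zero_add]
      rcases hFij.eq_or_lt with h0 | h0
      · simp [← h0]
      · have : (r (τ i) : ℝ) + 1 ≤ r j := by
          exact_mod_cast hr _ _ ⟨i, rfl, h0, not_le.1 hC⟩
        nlinarith
  calc _ ≤ ∑ i, ∑ j, (k * (if j ≠ τ i ∧ C i j ≤ C i (τ i) then F i j else 0) +
        F i j * ((r j : ℝ) - r (τ i))) :=
        Finset.sum_le_sum fun i _ => Finset.sum_le_sum fun j _ => hpt i j
    _ = _ := by simp only [Finset.sum_add_distrib, hbal, add_zero, ← Finset.mul_sum]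

theorem IsBalanced.card_mul_eq {σ : Fin n → Fin k} (hσ : IsBalanced σ) (a : Fin k) :
    k * (Finset.univ.filter fun i => σ i = a).card = n := by
  have h := Finset.card_eq_sum_card_fiberwise (s := (Finset.univ : Finset (Fin n)))
    (t := Finset.univ) (f := σ) (by simp)
  rw [Finset.sum_congr rfl fun b _ => hσ b a] at h
  simpa using h.symm

/-- The misclustering ratio of a first update, bounded by the number of triples `(a, b, i)` such
that `i` has label `a ≠ b` and is at least as close to the center for `b` as to that for `a`. -/
theorem IsFirstUpdate.misclusteringRatio_le {d : ℕ} {x : Fin n → E d} {μ₀ : Fin k → E d}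
    {σ : Fin n → Fin k} (hn : 0 < n) (hσ : IsBalanced σ) (hF : IsFirstUpdate x μ₀ F)
    (π : Equiv.Perm (Fin k)) :
    misclusteringRatio σ F ≤ k * ∑ p ∈ (Finset.univ : Finset (Fin k)).offDiag,
      ((Finset.univ.filter fun i => σ i = p.1 ∧
        ‖x i - μ₀ (π p.2)‖ ^ 2 ≤ ‖x i - μ₀ (π p.1)‖ ^ 2).card : ℝ) / n := by
  have hn' : (0 : ℝ) < n := Nat.cast_pos.2 hn
  have hfib : ∀ a, ((Finset.univ.filter fun i => π (σ i) = a).card : ℝ) * (1 / n) = 1 / k := by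
    intro a
    have h := hσ.card_mul_eq (π.symm a)
    have hk : (k : ℝ) ≠ 0 := Nat.cast_ne_zero.2 a.pos.ne'
    have h' : (k : ℝ) * (Finset.univ.filter fun i => σ i = π.symm a).card = n := by
      exact_mod_cast h
    simp only [← Equiv.eq_symm_apply]
    field_simp
    linarith
  have hopt := sum_offLabel_le (C := fun i j => ‖x i - μ₀ j‖ ^ 2) (τ := fun i => π (σ i))
    hF.1 (fun G hG => hF.2 hG) hfib
  have hinf : misclusteringRatio σ F ≤ ∑ i, ∑ j, if j = π (σ i) then 0 else F i j :=
    ciInf_le (Set.finite_range _).bddBelow π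
  refine hinf.trans (hopt.trans (mul_le_mul_of_nonneg_left ?_ (Nat.cast_nonneg k)))
  have hle : ∀ i j, F i j ≤ 1 / n := fun i j => by
    rw [← hF.1.2.2 i]
    exact Finset.single_le_sum (fun l _ => hF.1.1 i l) (Finset.mem_univ j)
  calc _ ≤ ∑ i, ∑ j, (if j ≠ π (σ i) ∧ ‖x i - μ₀ j‖ ^ 2 ≤ ‖x i - μ₀ (π (σ i))‖ ^ 2
          then 1 / (n : ℝ) else 0) := by
        refine Finset.sum_le_sum fun i _ => Finset.sum_le_sum fun j _ => ?_
        split_ifs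
        exacts [hle i j, le_rfl]
    _ = ∑ i, ∑ b, (if b ≠ σ i ∧ ‖x i - μ₀ (π b)‖ ^ 2 ≤ ‖x i - μ₀ (π (σ i))‖ ^ 2
          then 1 / (n : ℝ) else 0) := by
        refine Finset.sum_congr rfl fun i _ => ?_
        rw [← Equiv.sum_comp π]
        simp
    _ = ∑ i, ∑ b, ∑ a, (if (σ i = a ∧ ‖x i - μ₀ (π b)‖ ^ 2 ≤ ‖x i - μ₀ (π a)‖ ^ 2) ∧ a ≠ b
          then 1 / (n : ℝ) else 0) := by
        refine Finset.sum_congr rfl fun i _ => Finset.sum_congr rfl fun b _ => ?_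
        rw [Finset.sum_eq_single (σ i) (fun a _ ha => by simp [Ne.symm ha]) (by simp)]
        simp [and_comm, eq_comm]
    _ = ∑ a, ∑ b, ∑ i, (if (σ i = a ∧ ‖x i - μ₀ (π b)‖ ^ 2 ≤ ‖x i - μ₀ (π a)‖ ^ 2) ∧ a ≠ b
          then 1 / (n : ℝ) else 0) := by
        rw [Finset.sum_comm, Finset.sum_congr rfl fun b _ => Finset.sum_comm, Finset.sum_comm]
    _ = _ := by
        have hoff : (Finset.univ : Finset (Fin k)).offDiag =
            Finset.univ.filter fun p : Fin k × Fin k => p.1 ≠ p.2 := by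
          ext p
          simp
        rw [hoff, Finset.sum_filter, Fintype.sum_prod_type]
        refine Finset.sum_congr rfl fun a _ => Finset.sum_congr rfl fun b _ => ?_
        by_cases hab : a = b
        · simp [hab]
        · simp only [ne_eq, hab, not_false_eq_true, and_true, if_true]
          rw [← Finset.sum_filter, Finset.sum_const, nsmul_eq_mul, mul_one_div]

end Optimality

/-! ### Marginals of rotation invariant distributions on the ball -/

section RotationInvariance

variable {d : ℕ} {ν : Measure (E d)}

theorem IsRotInvariantOnUnitBall.integrable_exp_inner (hν : IsRotInvariantOnUnitBall ν)
    (w : E d) : Integrable (fun y => Real.exp (inner ℝ y w)) ν := by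
  have := hν.isProbabilityMeasure
  refine Integrable.of_bound (C := Real.exp ‖w‖) (by fun_prop) ?_
  filter_upwards [hν.ae_mem_ball] with y hy
  rw [Real.norm_eq_abs, Real.abs_exp, Real.exp_le_exp]
  have hy' : ‖y‖ ≤ 1 := by simpa using hy
  exact (real_inner_le_norm y w).trans (mul_le_of_le_one_left (norm_nonneg w) hy')

/-- The Laplace transform of a rotation invariant distribution is radial: a reflection maps `v` to
any other vector of the same norm. -/
theorem IsRotInvariantOnUnitBall.integral_exp_inner_eq (hν : IsRotInvariantOnUnitBall ν)
    {v w : E d} (h : ‖v‖ = ‖w‖) :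
    ∫ y, Real.exp (inner ℝ y v) ∂ν = ∫ y, Real.exp (inner ℝ y w) ∂ν := by
  set U : E d ≃ₗᵢ[ℝ] E d := (ℝ ∙ (v - w))ᗮ.reflection with hU
  have hUv : U v = w := Submodule.reflection_sub h
  calc ∫ y, Real.exp (inner ℝ y v) ∂ν = ∫ y, Real.exp (inner ℝ (U y) w) ∂ν := by
        simp only [← hUv, LinearIsometryEquiv.inner_map_map]
    _ = ∫ y, Real.exp (inner ℝ y w) ∂(ν.map U) :=
        (integral_map (f := fun y => Real.exp (inner ℝ y w)) U.continuous.aemeasurable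
          (by fun_prop)).symm
    _ = _ := by rw [hν.map_eq U]

/-- The sum over sign vectors of `exp (s ∑ᵢ ±yᵢ)` is at most `2ᵈ exp (s² ‖y‖² / 2)`. -/
theorem sum_exp_inner_sign_le (s : ℝ) (y : E d) :
    ∑ e ∈ Fintype.piFinset (fun _ : Fin d => ({1, -1} : Finset ℝ)),
      Real.exp (inner ℝ y (WithLp.toLp 2 fun i => s * e i)) ≤
      2 ^ d * Real.exp (s ^ 2 * ‖y‖ ^ 2 / 2) := by
  have hne : (1 : ℝ) ≠ -1 := by norm_num
  calc _ = ∑ e ∈ Fintype.piFinset (fun _ : Fin d => ({1, -1} : Finset ℝ)),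
        ∏ i, Real.exp (e i * (s * y i)) := by
        refine Finset.sum_congr rfl fun e _ => ?_
        rw [← Real.exp_sum]
        congr 1
        simp only [PiLp.inner_apply, RCLike.inner_apply, conj_trivial]
        exact Finset.sum_congr rfl fun i _ => by ring
    _ = ∏ i, ∑ e ∈ ({1, -1} : Finset ℝ), Real.exp (e * (s * y i)) :=
        (Finset.prod_univ_sum _ fun i e => Real.exp (e * (s * y i))).symm
    _ = ∏ i, 2 * Real.cosh (s * y i) := by
        refine Finset.prod_congr rfl fun i _ => ?_
        rw [Finset.sum_pair hne, Real.cosh_eq]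
        ring_nf
    _ ≤ ∏ i, 2 * Real.exp ((s * y i) ^ 2 / 2) := by
        refine Finset.prod_le_prod (fun i _ => by positivity) fun i _ => ?_
        have := Real.cosh_le_exp_half_sq (s * y i)
        linarith
    _ = _ := by
        rw [Finset.prod_mul_distrib, Finset.prod_const, Finset.card_univ, Fintype.card_fin,
          ← Real.exp_sum, EuclideanSpace.real_norm_sq_eq, ← Finset.sum_div, Finset.mul_sum]
        simp only [mul_pow]

/-- The one-dimensional marginals of a rotation invariant distribution on the unit ball are
subgaussian with variance proxy `1/d`. -/
theorem IsRotInvariantOnUnitBall.hasSubgaussianMGF_inner (hν : IsRotInvariantOnUnitBall ν)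
    (hd : 0 < d) {u : E d} (hu : ‖u‖ = 1) :
    HasSubgaussianMGF (fun y => inner ℝ y u) (1 / (d : NNReal)) ν := by
  have := hν.isProbabilityMeasure
  have hd' : (0 : ℝ) < d := Nat.cast_pos.2 hd
  have hsm : ∀ t : ℝ, ∀ y : E d, t * inner ℝ y u = inner ℝ y (t • u) := fun t y => by
    rw [real_inner_smul_right]
  refine ⟨fun t => ?_, fun t => ?_⟩
  · simp only [hsm]
    exact hν.integrable_exp_inner _
  simp only [mgf, hsm]
  -- The sign vectors are scaled to have the norm of `t • u`.
  set s : ℝ := t / Real.sqrt d with hs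
  have hs2 : s ^ 2 = t ^ 2 / d := by rw [hs, div_pow, Real.sq_sqrt hd'.le]
  set S := Fintype.piFinset (fun _ : Fin d => ({1, -1} : Finset ℝ)) with hS
  have hcard : (S.card : ℝ) = 2 ^ d := by
    have h2 : ({1, -1} : Finset ℝ).card = 2 := Finset.card_pair (by norm_num)
    simp [hS, Fintype.card_piFinset, h2]
  have hnorm : ∀ e ∈ S, ‖t • u‖ = ‖(WithLp.toLp 2 fun i => s * e i : E d)‖ := by
    intro e he
    have he2 : ∀ i, e i ^ 2 = 1 := fun i => by
      have := Fintype.mem_piFinset.1 he i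
      simp only [Finset.mem_insert, Finset.mem_singleton] at this
      rcases this with h | h <;> simp [h]
    rw [← sq_eq_sq₀ (norm_nonneg _) (norm_nonneg _), norm_smul, hu, mul_one,
      EuclideanSpace.real_norm_sq_eq]
    simp only [mul_pow, he2, hs2, Real.norm_eq_abs, sq_abs, Finset.sum_const, Finset.card_univ,
      Fintype.card_fin, nsmul_eq_mul]
    field_simp
  have hsum : (2 : ℝ) ^ d * ∫ y, Real.exp (inner ℝ y (t • u)) ∂ν ≤
      2 ^ d * Real.exp (s ^ 2 / 2) := by
    calc (2 : ℝ) ^ d * ∫ y, Real.exp (inner ℝ y (t • u)) ∂ν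
        = ∑ e ∈ S, ∫ y, Real.exp (inner ℝ y (WithLp.toLp 2 fun i => s * e i : E d)) ∂ν := by
          rw [← hcard, ← nsmul_eq_mul, ← Finset.sum_const]
          exact Finset.sum_congr rfl fun e he => hν.integral_exp_inner_eq (hnorm e he)
      _ = ∫ y, ∑ e ∈ S, Real.exp (inner ℝ y (WithLp.toLp 2 fun i => s * e i : E d)) ∂ν :=
          (integral_finsetSum _ fun e _ => hν.integrable_exp_inner _).symm
      _ ≤ ∫ _, 2 ^ d * Real.exp (s ^ 2 / 2) ∂ν := by
          refine integral_mono_ae (integrable_finsetSum _ fun e _ => hν.integrable_exp_inner _)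
            (integrable_const _) ?_
          filter_upwards [hν.ae_mem_ball] with y hy
          have hy' : ‖y‖ ≤ 1 := by simpa using hy
          refine (sum_exp_inner_sign_le s y).trans ?_
          gcongr
          exact mul_le_of_le_one_right (sq_nonneg s) (pow_le_one₀ (norm_nonneg y) hy')
      _ = _ := by simp
  refine (le_of_mul_le_mul_left hsum (by positivity)).trans_eq ?_
  rw [hs2]
  congr 1
  push_cast
  ring

/-- If `c + y` is at least as close to `q` as to `p`, where `‖c - q‖` exceeds `‖c - p‖` by `2 t`,
then `y` has a component of length at least `t` in the direction from `p` to `q`. -/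
theorem inner_ge_of_dist_le {H : Type*} [NormedAddCommGroup H] [InnerProductSpace ℝ H]
    {c y p q : H} {t : ℝ} (ht : 0 ≤ t) (h : 2 * t ≤ ‖c - q‖ - ‖c - p‖)
    (hy : ‖c + y - q‖ ^ 2 ≤ ‖c + y - p‖ ^ 2) : t * ‖q - p‖ ≤ inner ℝ y (q - p) := by
  have e1 : c + y - q = (c - q) + y := by abel
  have e2 : c + y - p = (c - p) + y := by abel
  have e3 : q - p = (c - p) - (c - q) := by abel
  rw [e1, e2, norm_add_sq_real, norm_add_sq_real] at hy
  have htri : ‖q - p‖ ≤ ‖c - p‖ + ‖c - q‖ := by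
    rw [e3]
    exact norm_sub_le _ _
  have hin : inner ℝ y (q - p) = inner ℝ (c - p) y - inner ℝ (c - q) y := by
    rw [e3, inner_sub_right, real_inner_comm, real_inner_comm y (c - q)]
  rw [hin]
  nlinarith [mul_le_mul_of_nonneg_left htri ht, norm_nonneg (c - p), norm_nonneg (c - q)]

/-- The probability that a noisy point around the center `c` is misclassified as nearest to `q`
when its approximate center is `p`. -/
theorem IsRotInvariantOnUnitBall.measureReal_dist_le_le (hν : IsRotInvariantOnUnitBall ν)
    {c p q : E d} {t : ℝ} (h : 2 * t ≤ ‖c - q‖ - ‖c - p‖) :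
    ν.real {y | ‖c + y - q‖ ^ 2 ≤ ‖c + y - p‖ ^ 2} ≤
      Real.exp (-((d : ℝ) / 2) * (max t 0) ^ 2) := by
  have := hν.isProbabilityMeasure
  -- For `t ≤ 0` or `d = 0` the right-hand side is `1`.
  rcases le_or_gt t 0 with ht | ht
  · simp [max_eq_right ht]
  rcases Nat.eq_zero_or_pos d with rfl | hd
  · simp
  have hpq : 0 < ‖q - p‖ := by
    rw [norm_pos_iff, sub_ne_zero]
    rintro rfl
    linarith
  set u := ‖q - p‖⁻¹ • (q - p) with hu
  have hu1 : ‖u‖ = 1 := by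
    rw [hu, norm_smul, norm_inv, norm_norm, inv_mul_cancel₀ hpq.ne']
  have hsub := (hν.hasSubgaussianMGF_inner hd hu1).measure_ge_le ht.le
  refine (measureReal_mono (fun y hy => ?_)).trans (hsub.trans_eq ?_)
  · have := inner_ge_of_dist_le ht.le h hy
    rw [Set.mem_ofPred_eq, hu, real_inner_smul_right, inv_mul_eq_div, le_div_iff₀ hpq]
    exact this
  · rw [max_eq_left ht.le]
    congr 1
    have hd' : (d : ℝ) ≠ 0 := Nat.cast_ne_zero.2 hd.ne'
    push_cast
    field_simp

end RotationInvariance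

/-! ### Concentration of empirical frequencies -/

/-- Hoeffding's inequality for the number of samples, among those indexed by `s`, lying in a
measurable set. -/
theorem measureReal_card_ge_le {Ω X ι : Type*} [MeasurableSpace Ω] [MeasurableSpace X]
    {P : Measure Ω} [IsProbabilityMeasure P] {ν : Measure X} {g : ι → Ω → X}
    (hg : ∀ i, Measurable (g i)) (hlaw : ∀ i, P.map (g i) = ν) (hind : iIndepFun g P)
    {S : Set X} [DecidablePred (· ∈ S)] (hS : MeasurableSet S) (s : Finset ι) {t : ℝ}
    (ht : 0 ≤ t) :
    P.real {ω | s.card * (ν.real S + t) ≤ ((s.filter fun i => g i ω ∈ S).card : ℝ)} ≤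
      Real.exp (-(2 * s.card * t ^ 2)) := by
  set f : X → ℝ := S.indicator 1 with hf
  have hfm : Measurable f := measurable_one.indicator hS
  have hmean : ∀ i, ∫ ω, f (g i ω) ∂P = ν.real S := fun i => by
    rw [← integral_map (hg i).aemeasurable hfm.aestronglyMeasurable, hlaw i, hf,
      integral_indicator_one hS]
  have hsub : ∀ i ∈ s, HasSubgaussianMGF (fun ω => f (g i ω) - ν.real S)
      ((‖(1 : ℝ) - 0‖₊ / 2) ^ 2) P := fun i _ => by
    rw [← hmean i]
    refine hasSubgaussianMGF_of_mem_Icc (hfm.comp (hg i)).aemeasurable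
      (Filter.Eventually.of_forall fun ω => ?_)
    by_cases h : g i ω ∈ S <;> simp [hf, h]
  have hindf : iIndepFun (fun i ω => f (g i ω) - ν.real S) P :=
    hind.comp (fun _ y => f y - ν.real S) fun _ => hfm.sub_const _
  have key := HasSubgaussianMGF.measure_sum_ge_le_of_iIndepFun hindf hsub
    (ε := s.card * t) (by positivity)
  refine (measureReal_mono fun ω hω => ?_).trans (key.trans_eq ?_)
  · have hsum : ∑ i ∈ s, f (g i ω) = ((s.filter fun i => g i ω ∈ S).card : ℝ) := by
      rw [Finset.card_filter]
      push_cast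
      exact Finset.sum_congr rfl fun i _ => by simp [hf, Set.indicator_apply]
    rw [Set.mem_ofPred_eq] at hω ⊢
    rw [Finset.sum_sub_distrib, hsum, Finset.sum_const, nsmul_eq_mul]
    linarith
  · congr 1
    rcases s.eq_empty_or_nonempty with rfl | hs
    · simp
    · have : (s.card : ℝ) ≠ 0 := Nat.cast_ne_zero.2 (Finset.card_pos.2 hs).ne'
      simp
      field_simp

/-! ### Monotonicity of the bound -/

section Monotonicity

variable {k : ℕ} {ε : ℝ}

theorem two_le_mul_pred (hk : 2 ≤ k) : (2 : ℝ) ≤ (k : ℝ) * ((k : ℝ) - 1) := by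
  have : (2 : ℝ) ≤ k := by exact_mod_cast hk
  nlinarith

theorem log_pairs_div_pos (hk : 2 ≤ k) (hε₀ : 0 < ε) (hε₁ : ε < 1) :
    0 < Real.log ((k : ℝ) * ((k : ℝ) - 1) / ε) := by
  refine Real.log_pos ((one_lt_div hε₀).2 ?_)
  linarith [two_le_mul_pred hk]

/-- In all arguments but `k`, `n` and `ε`, the bound depends on `d max(Δ/2 - δ, 0)²` only and
decreases in it; this covers the degenerate case `n = 0` as well. -/
theorem ratioBound_le_iff (hk : 2 ≤ k) {n d d' : ℕ} {Δ Δ' δ δ' : ℝ} :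
    ratioBound k n d Δ δ ε ≤ ratioBound k n d' Δ' δ' ε ↔
      (d' : ℝ) * (max (Δ' / 2 - δ') 0) ^ 2 ≤ d * (max (Δ / 2 - δ) 0) ^ 2 := by
  have h : (0 : ℝ) < (k : ℝ) * ((k : ℝ) - 1) := by linarith [two_le_mul_pred hk]
  rw [ratioBound, ratioBound, mul_le_mul_iff_right₀ h, add_le_add_iff_right, Real.exp_le_exp]
  constructor <;> intro h <;> linarith

theorem ratioBound_lt_iff (hk : 2 ≤ k) {n d d' : ℕ} {Δ Δ' δ δ' : ℝ} :
    ratioBound k n d Δ δ ε < ratioBound k n d' Δ' δ' ε ↔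
      (d' : ℝ) * (max (Δ' / 2 - δ') 0) ^ 2 < d * (max (Δ / 2 - δ) 0) ^ 2 := by
  rw [← not_le, ratioBound_le_iff hk, not_le]

theorem ratioBound_strictAntiOn_sampleSize (hk : 2 ≤ k) (hε₀ : 0 < ε) (hε₁ : ε < 1) (d : ℕ)
    (Δ δ : ℝ) : StrictAntiOn (fun n : ℕ => ratioBound k n d Δ δ ε) (Set.Ici 1) := by
  intro m hm n _ hmn
  have h : (0 : ℝ) < (k : ℝ) * ((k : ℝ) - 1) := by linarith [two_le_mul_pred hk]
  have hL := log_pairs_div_pos hk hε₀ hε₁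
  have hk' : (0 : ℝ) < k := by exact_mod_cast (by omega : 0 < k)
  have hm' : (0 : ℝ) < m := Nat.cast_pos.2 hm
  have hmn' : (m : ℝ) < n := Nat.cast_lt.2 hmn
  simp only [ratioBound]
  gcongr

end Monotonicity

/-! ### The misclustering bound -/

theorem separation_le {k d : ℕ} (c : Fin k → E d) {a b : Fin k} (hab : a ≠ b) :
    separation c ≤ ‖c a - c b‖ :=
  ciInf_le (Set.finite_range _).bddBelow (⟨(a, b), hab⟩ : {p : Fin k × Fin k // p.1 ≠ p.2})

theorem exists_perm_forall_le_initDist {k d : ℕ} (μ₀ c : Fin k → E d) :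
    ∃ π : Equiv.Perm (Fin k), ∀ j, ‖μ₀ (π j) - c j‖ ≤ initDist μ₀ c := by
  obtain ⟨π, hπ⟩ := exists_eq_ciInf_of_finite
    (f := fun π : Equiv.Perm (Fin k) => ⨆ j, ‖μ₀ (π j) - c j‖)
  refine ⟨π, fun j => ?_⟩
  rw [initDist, ← hπ]
  exact le_ciSup (f := fun j => ‖μ₀ (π j) - c j‖) (Set.finite_range _).bddAbove j

/-- Outside an event of probability at most `ε`, every first update of data from the stochastic
ball model obeys the misclustering bound. -/
theorem IsStochasticBallModel.measureReal_ratioBound_lt_le {Ω : Type*} [MeasurableSpace Ω]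
    {P : Measure Ω} [IsProbabilityMeasure P] {k n d : ℕ} (hk : 2 ≤ k) {ε : ℝ} (hε₀ : 0 < ε)
    (hε₁ : ε < 1) (hn : 0 < n) {c : Fin k → E d} (μ₀ : Fin k → E d) {σ : Fin n → Fin k}
    (hσ : IsBalanced σ) {x : Fin n → Ω → E d} (hx : IsStochasticBallModel P c σ x) :
    P.real {ω | ∃ F : Matrix (Fin n) (Fin k) ℝ, IsFirstUpdate (fun i => x i ω) μ₀ F ∧
      ratioBound k n d (separation c) (initDist μ₀ c) ε < misclusteringRatio σ F} ≤ ε := by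
  obtain ⟨ν, g, hν, hg, hlaw, hind, hxg⟩ := hx
  obtain ⟨π, hπ⟩ := exists_perm_forall_le_initDist μ₀ c
  set N : ℝ := (k : ℝ) * ((k : ℝ) - 1) with hN
  have hN2 : 2 ≤ N := two_le_mul_pred hk
  set L := Real.log (N / ε) with hL
  have hLpos : 0 < L := log_pairs_div_pos hk hε₀ hε₁
  set t := Real.sqrt ((k : ℝ) / (2 * (n : ℝ)) * L) with ht
  set q := Real.exp (-((d : ℝ) / 2) * (max (separation c / 2 - initDist μ₀ c) 0) ^ 2) with hq
  have hk' : (0 : ℝ) < k := by exact_mod_cast (by omega : 0 < k)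
  have hn' : (0 : ℝ) < n := Nat.cast_pos.2 hn
  have hfib : ∀ a, (k : ℝ) * ((Finset.univ.filter fun i => σ i = a).card : ℝ) = n := fun a => by
    exact_mod_cast hσ.card_mul_eq a
  -- The noise vectors for which a point of label `p.1` may be assigned to `p.2`.
  set S : Fin k × Fin k → Set (E d) := fun p =>
    {y | ‖c p.1 + y - μ₀ (π p.2)‖ ^ 2 ≤ ‖c p.1 + y - μ₀ (π p.1)‖ ^ 2} with hS
  have hSm : ∀ p, MeasurableSet (S p) := fun p =>
    measurableSet_le (by fun_prop) (by fun_prop)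
  have hSq : ∀ p : Fin k × Fin k, p.1 ≠ p.2 → ν.real (S p) ≤ q := by
    intro p hp
    refine hν.measureReal_dist_le_le ?_
    have h1 := separation_le c hp
    have h2 := hπ p.1
    have h3 := hπ p.2
    have h4 : ‖c p.1 - c p.2‖ ≤ ‖c p.1 - μ₀ (π p.2)‖ + ‖μ₀ (π p.2) - c p.2‖ :=
      norm_sub_le_norm_sub_add_norm_sub _ _ _
    rw [norm_sub_rev (μ₀ (π p.1))] at h2
    linarith
  classical
  set A : Fin k × Fin k → Set Ω := fun p =>
    {ω | (Finset.univ.filter fun i => σ i = p.1).card * (ν.real (S p) + t) ≤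
      (((Finset.univ.filter fun i => σ i = p.1).filter fun i => g i ω ∈ S p).card : ℝ)} with hA
  have hAP : ∀ p, P.real (A p) ≤ ε / N := by
    intro p
    refine (measureReal_card_ge_le hg hlaw hind (hSm p) _ (Real.sqrt_nonneg _)).trans_eq ?_
    -- The deviation `t` is chosen such that Hoeffding's bound is `exp (-L) = ε / N`.
    have hexp : 2 * ((Finset.univ.filter fun i => σ i = p.1).card : ℝ) * t ^ 2 = L := by
      rw [ht, Real.sq_sqrt (by positivity)]
      have h := hfib p.1
      field_simp
      linarith
    rw [hexp, hL, Real.exp_neg, Real.exp_log (by positivity), inv_div]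
  have hcardN : ((Finset.univ : Finset (Fin k)).offDiag.card : ℝ) = N := by
    rw [Finset.offDiag_card, Finset.card_univ, Fintype.card_fin,
      Nat.cast_sub (Nat.le_mul_self k), hN]
    push_cast
    ring
  have hsub : {ω | ∃ F : Matrix (Fin n) (Fin k) ℝ, IsFirstUpdate (fun i => x i ω) μ₀ F ∧
      ratioBound k n d (separation c) (initDist μ₀ c) ε < misclusteringRatio σ F} ⊆
      ⋃ p ∈ (Finset.univ : Finset (Fin k)).offDiag, A p := by
    rintro ω ⟨F, hF, hlt⟩
    by_contra hω
    simp only [Set.mem_iUnion, not_exists] at hω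
    refine hlt.not_ge ((hF.misclusteringRatio_le hn hσ π).trans ?_)
    have hterm : ∀ p ∈ (Finset.univ : Finset (Fin k)).offDiag,
        ((Finset.univ.filter fun i => σ i = p.1 ∧
          ‖x i ω - μ₀ (π p.2)‖ ^ 2 ≤ ‖x i ω - μ₀ (π p.1)‖ ^ 2).card : ℝ) / n ≤
          (q + t) / k := by
      intro p hp
      have hset : (Finset.univ.filter fun i => σ i = p.1 ∧
          ‖x i ω - μ₀ (π p.2)‖ ^ 2 ≤ ‖x i ω - μ₀ (π p.1)‖ ^ 2) =
          (Finset.univ.filter fun i => σ i = p.1).filter fun i => g i ω ∈ S p := by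
        rw [Finset.filter_filter]
        refine Finset.filter_congr fun i _ => and_congr_right fun hi => ?_
        rw [hxg, hi]
        rfl
      have hnot := hω p hp
      rw [hA, Set.mem_ofPred_eq, not_le] at hnot
      have hne : p.1 ≠ p.2 := (Finset.mem_offDiag.1 hp).2.2
      rw [hset, div_le_div_iff₀ hn' hk', ← hfib p.1]
      have hm : (0 : ℝ) ≤ (Finset.univ.filter fun i => σ i = p.1).card := Nat.cast_nonneg _
      have h5 := mul_le_mul_of_nonneg_left (hSq p hne) hm
      nlinarith
    calc _ ≤ (k : ℝ) * ∑ p ∈ (Finset.univ : Finset (Fin k)).offDiag, (q + t) / k :=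
          mul_le_mul_of_nonneg_left (Finset.sum_le_sum hterm) hk'.le
      _ = N * (q + t) := by
          rw [Finset.sum_const, nsmul_eq_mul, hcardN]
          field_simp
      _ = _ := rfl
  calc _ ≤ P.real (⋃ p ∈ (Finset.univ : Finset (Fin k)).offDiag, A p) :=
        measureReal_mono hsub (measure_ne_top _ _)
    _ ≤ ∑ p ∈ (Finset.univ : Finset (Fin k)).offDiag, P.real (A p) :=
        measureReal_biUnion_finset_le _ _
    _ ≤ ∑ p ∈ (Finset.univ : Finset (Fin k)).offDiag, ε / N :=
        Finset.sum_le_sum fun p _ => hAP p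
    _ = ε := by
        rw [Finset.sum_const, nsmul_eq_mul, hcardN]
        field_simp

end BalLOT

theorem theorem5 {Ω : Type*} [MeasurableSpace Ω] (P : Measure Ω) [IsProbabilityMeasure P]
    (k : ℕ) (hk : 2 ≤ k) (ε : ℝ) (hε₀ : 0 < ε) (hε₁ : ε < 1) :
    -- with probability at least `1 - ε`, every first update satisfies the bound
    (∀ (n d : ℕ) (_hn : 0 < n) (c μ₀ : Fin k → BalLOT.E d) (σ : Fin n → Fin k)
        (_hσ : BalLOT.IsBalanced σ) (x : Fin n → Ω → BalLOT.E d)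
        (_hx : BalLOT.IsStochasticBallModel P c σ x),
      P.real {ω | ∃ F : Matrix (Fin n) (Fin k) ℝ,
          BalLOT.IsFirstUpdate (fun i => x i ω) μ₀ F ∧
          BalLOT.ratioBound k n d (BalLOT.separation c) (BalLOT.initDist μ₀ c) ε <
            BalLOT.misclusteringRatio σ F} ≤ ε) ∧
    -- the bound decreases as `n` grows
    (∀ (d : ℕ) (Δ δ : ℝ),
      StrictAntiOn (fun n : ℕ => BalLOT.ratioBound k n d Δ δ ε) (Set.Ici 1)) ∧
    -- the bound decreases as `d` grows
    (∀ (n : ℕ) (Δ δ : ℝ),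
      Antitone (fun d : ℕ => BalLOT.ratioBound k n d Δ δ ε) ∧
      (δ < Δ / 2 → StrictAnti (fun d : ℕ => BalLOT.ratioBound k n d Δ δ ε))) ∧
    -- the bound decreases as `Δ` grows
    (∀ (n d : ℕ) (δ : ℝ),
      Antitone (fun Δ : ℝ => BalLOT.ratioBound k n d Δ δ ε) ∧
      (0 < d → StrictAntiOn (fun Δ : ℝ => BalLOT.ratioBound k n d Δ δ ε) (Set.Ici (2 * δ)))) ∧
    -- the bound decreases as the initialization approaches the planted means
    (∀ (n d : ℕ) (Δ : ℝ),
      Monotone (fun δ : ℝ => BalLOT.ratioBound k n d Δ δ ε) ∧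
      (0 < d → StrictMonoOn (fun δ : ℝ => BalLOT.ratioBound k n d Δ δ ε) (Set.Iic (Δ / 2)))) := by
  refine ⟨fun n d hn c μ₀ σ hσ x hx => hx.measureReal_ratioBound_lt_le hk hε₀ hε₁ hn μ₀ hσ,
    BalLOT.ratioBound_strictAntiOn_sampleSize hk hε₀ hε₁, fun n Δ δ => ⟨fun d d' h => ?_,
    fun hδ d d' h => ?_⟩, fun n d δ => ⟨fun Δ Δ' h => ?_, fun hd Δ hΔ Δ' _ h => ?_⟩,
    fun n d Δ => ⟨fun δ δ' h => ?_, fun hd δ _ δ' hδ' h => ?_⟩⟩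
  · refine (BalLOT.ratioBound_le_iff hk).2 ?_
    gcongr
  · refine (BalLOT.ratioBound_lt_iff hk).2 ?_
    rw [max_eq_left (by linarith)]
    exact mul_lt_mul_of_pos_right (Nat.cast_lt.2 h) (pow_pos (by linarith) 2)
  · refine (BalLOT.ratioBound_le_iff hk).2 ?_
    gcongr
  · refine (BalLOT.ratioBound_lt_iff hk).2 ?_
    rw [Set.mem_Ici] at hΔ
    rw [max_eq_left (by linarith), max_eq_left (by linarith)]
    exact mul_lt_mul_of_pos_left (pow_lt_pow_left₀ (by linarith) (by linarith) two_ne_zero)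
      (Nat.cast_pos.2 hd)
  · refine (BalLOT.ratioBound_le_iff hk).2 ?_
    gcongr
  · refine (BalLOT.ratioBound_lt_iff hk).2 ?_
    rw [Set.mem_Iic] at hδ'
    rw [max_eq_left (by linarith), max_eq_left (by linarith)]
    exact mul_lt_mul_of_pos_left (pow_lt_pow_left₀ (by linarith) (by linarith) two_ne_zero)
      (Nat.cast_pos.2 hd)
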